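/- Let $H$ be a real Hilbert space with scalar product $\langle\cdot\mid\cdot\rangle$. Set-valued operators are maps $A\colon H\to 2^H$; $\operatorname{zer}A=\{x: 0\in Ax\}$, and the resolvent of $A$ is $J_A=(\mathrm{Id}+A)^{-1}$, that is, $p\in J_Az$ if and only if $z-p\in Ap$. $A$ is monotone if $\langle x-y\mid u-v\rangle\ge 0$ whenever $u\in Ax$, $v\in Ay$, and maximally monotone if moreover no monotone operator has a strictly larger graph. $B\colon H\to H$ is $\beta$-cocoercive if $\langle x-y\mid Bx-By\rangle\ge\beta\|Bx-By\|^2$ for all $x,y\in H$. $A$ is demiregular at $x$ if $Ax\ne\varnothing$ and, for every sequence $(x_n,u_n)$ with $u_n\in Ax_n$ and every $u\in Ax$ such that $x_n\rightharpoonup x$ and $u_n\to u$, one has $x_n\to x$. For bounded self-adjoint operators $U,V$ on $H$, $U\succcurlyeq V$ means $\langle Ux\mid x\rangle\ge\langle Vx\mid x\rangle$ for all $x\in H$, and $\mathcal P_\alpha(H)$ is the set of bounded self-adjoint $U$ with $U\succcurlyeq\alpha\,\mathrm{Id}$. **Proposition.** Let $\beta>0$, let $\varepsilon\in\,]0,\min\{1/2,\beta\}[$,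 let $\alpha>0$, let $(\eta_n)_{n\in\mathbb N}$ be a summable sequence in $[0,+\infty[$, and let $(U_n)_{n\in\mathbb N}$ be a sequence in $\mathcal P_\alpha(H)$ such that $$\sup_{n\in\mathbb N}\|U_n\|<+\infty\quad\text{and}\quad(\forall n\in\mathbb N)\quad(1+\eta_n)U_{n+1}\succcurlyeq U_n.$$ Let $x_0\in H$, let $A\colon H\to2^H$ be maximally monotone, let $B\colon H\to H$ be $\beta$-cocoercive, and let $(a_n)_{n\in\mathbb N}$, $(b_n)_{n\in\mathbb N}$ be sequences in $H$ with $\sum_n\|a_n\|<+\infty$ and $\sum_n\|b_n\|<+\infty$. Suppose that $\operatorname{zer}(A+B)\neq\varnothing$ and, for every $n\in\mathbb N$, let $$\gamma_n\in\left[\varepsilon,\frac{2\beta}{(1+\varepsilon)\|U_n\|}\right]\quad\text{and}\quad\lambda_n\in\left[\varepsilon,\,1+(1-\varepsilon)\Big(1-\frac{\gamma_n\|U_n\|}{2\beta}\Big)\right].$$ Then, for every $n$, the resolvent $J_{\gamma_nU_nA}$ is single-valued and defined on all of $H$, and for the sequence generated by $$x_{n+1}=x_n+\lambda_n\Big(J_{\gamma_nU_nA}\big(x_n-\gamma_nU_n(Bx_n+b_n)\big)+a_n-x_n\Big)\qquad(n\in\mathbb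 N)$$ the following hold: 1. $\sum_{n\in\mathbb N}\|J_{\gamma_nU_nA}(x_n-\gamma_nU_nBx_n)-x_n\|^2<+\infty$. 2. For every $x\in\operatorname{zer}(A+B)$, $\sum_{n\in\mathbb N}\|Bx_n-Bx\|^2<+\infty$. 3. $(x_n)_{n\in\mathbb N}$ converges weakly to a point in $\operatorname{zer}(A+B)$. 4. Suppose that one of the following holds: (a) $A$ is demiregular at every point of $\operatorname{zer}(A+B)$; (b) $B$ is demiregular at every point of $\operatorname{zer}(A+B)$; (c) $\operatorname{int}\operatorname{zer}(A+B)\neq\varnothing$. Then $(x_n)_{n\in\mathbb N}$ converges strongly to a point in $\operatorname{zer}(A+B)$. -/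

import Mathlib

open Filter Topology
open scoped Pointwise

/-! Set-valued operators `A : H → 2^H` are represented as functions `A : H → Set H`; sums of
set-valued operators are pointwise Minkowski sums. -/

namespace MonotoneOp

section Algebra

variable {H : Type*}

/-- A single-valued operator `B : H → H` seen as the set-valued operator `x ↦ {B x}`. -/
def ofFun (B : H → H) : H → Set H := fun x => {B x}

/-- The inverse of a set-valued operator: its graph is `{(u, x) | u ∈ A x}`. -/
def inv (A : H → Set H) : H → Set H := fun u => {x | u ∈ A x}

/-- The set of zeros `zer A = {x | 0 ∈ A x}`. -/
def zer [Zero H] (A : H → Set H) : Set H := {x | (0 : H) ∈ A x}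

/-- The resolvent `J_A = (Id + A)⁻¹`, as a set-valued operator. -/
def resolvent [Add H] (A : H → Set H) : H → Set H := inv (ofFun id + A)

open Classical in
/-- The resolvent as a map `H → H`: a selection of the set-valued resolvent. The value is `0` at
a point where the set-valued resolvent is empty. -/
noncomputable def resolventMap [AddCommGroup H] (A : H → Set H) (z : H) : H :=
  if h : (resolvent A z).Nonempty then h.choose else 0

end Algebra

section Hilbert

variable {H : Type*} [NormedAddCommGroup H] [InnerProductSpace ℝ H]

/-- Composition `L A : x ↦ L (A x)` of a bounded linear operator `L` with a set-valued
operator `A`. -/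
def linComp (L : H →L[ℝ] H) (A : H → Set H) : H → Set H := fun x => L '' A x

/-- Monotone set-valued operators. -/
def IsMonotone (A : H → Set H) : Prop :=
  ∀ x, ∀ u ∈ A x, ∀ y, ∀ v ∈ A y, 0 ≤ inner ℝ (x - y) (u - v)

/-- Maximally monotone operators: monotone, and no monotone operator has a strictly larger
graph. -/
def IsMaximallyMonotone (A : H → Set H) : Prop :=
  IsMonotone A ∧ ∀ A' : H → Set H, IsMonotone A' → (∀ x, A x ⊆ A' x) → A' = A

/-- `B : H → H` is cocoercive with constant `β`. -/
def IsCocoercive (β : ℝ) (B : H → H) : Prop :=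
  ∀ x y, β * ‖B x - B y‖ ^ 2 ≤ inner ℝ (x - y) (B x - B y)

/-- Weak convergence of a sequence: convergence in the weak topology of `H`. -/
def WeaklyTendsto (x : ℕ → H) (a : H) : Prop :=
  Tendsto (fun n => toWeakSpace ℝ H (x n)) atTop (𝓝 (toWeakSpace ℝ H a))

/-- `A` is demiregular at the point `x` of its domain: whenever `(xₙ, uₙ)` is a sequence in the
graph of `A` and `u ∈ A x` are such that `xₙ ⇀ x` and `uₙ → u`, then `xₙ → x`. -/
def IsDemiregularAt (A : H → Set H) (x : H) : Prop :=
  (A x).Nonempty ∧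
    ∀ (xs us : ℕ → H), (∀ n, us n ∈ A (xs n)) → ∀ u ∈ A x,
      WeaklyTendsto xs x → Tendsto us atTop (𝓝 u) → Tendsto xs atTop (𝓝 x)

/-- The class `P_α(H)` of bounded self-adjoint operators `U` with `U ≽ α Id`, where `≽` is the
Loewner order. -/
def posOps [CompleteSpace H] (α : ℝ) : Set (H →L[ℝ] H) :=
  {U | IsSelfAdjoint U ∧ α • ContinuousLinearMap.id ℝ H ≤ U}

end Hilbert

end MonotoneOp

/-! With `Wₙ = Uₙ⁻¹`, the iteration is a relaxed forward-backward step in the metric `⟨Wₙ · | ·⟩`.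
Let `pₙ` be the exact resolvent point and `wₙ ∈ A pₙ` the element defining it. For a zero `z`,
monotonicity of `A`, cocoercivity of `B` and the ranges of `γₙ`, `λₙ` make the squared `Wₙ`-distance
to `z` drop by a fixed multiple of `⟨Wₙ(pₙ - xₙ) | pₙ - xₙ⟩ + ‖B xₙ - B z‖²`
(`IsMetricPair.relaxed_step_le`, `exists_descent_constants`). The errors `aₙ`, `bₙ` and the change
of metric, `Wₙ₊₁ ≼ (1 + ηₙ) Wₙ`, cost only summable amounts, so a Robbins-Siegmund argument gives 1,
2 and convergence of the distances.

For 3, `Wₙ` converges pointwise in norm, so Opial's argument survives the variable metric. Weak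
cluster points are zeros because `pₙ - xₙ → 0`, `B xₙ → B z` and `wₙ → -B z`. For 4, demiregularity
applies to `(pₙ, wₙ)` or `(xₙ, B xₙ)`; in the interior case the quasi-Fejér inequality, uniform over
a ball of zeros, forces norm convergence.

The resolvent exists by a Minty theorem, proved by minimizing the Fitzpatrick function of `A` plus a
quadratic energy. -/

namespace MonotoneOp

/-! ### Coercive symmetric operators and their inverses -/

section SymmetricOperators

variable {H : Type*} [NormedAddCommGroup H] [InnerProductSpace ℝ H]

/-- Cauchy-Schwarz for a symmetric operator `T` with `0 ≤ T ≤ c Id`. -/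
theorem norm_apply_sq_le_of_nonneg_of_le {T : H →L[ℝ] H} {c : ℝ} (hc : 0 < c)
    (hT : ∀ x y, inner ℝ (T x) y = inner ℝ x (T y)) (h0 : ∀ x, 0 ≤ inner ℝ (T x) x)
    (h1 : ∀ x, inner ℝ (T x) x ≤ c * ‖x‖ ^ 2) (x : H) :
    ‖T x‖ ^ 2 ≤ c * inner ℝ (T x) x := by
  -- Positivity at `c x - T x` reads `0 ≤ c²⟨Tx|x⟩ - 2c‖Tx‖² + ⟨T(Tx)|Tx⟩`, and the last term is at
  -- most `c‖Tx‖²`.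
  have h2 := h0 (c • x - T x)
  have h3 := h1 (T x)
  have h4 := hT (T x) x
  simp only [map_sub, map_smul, inner_sub_left, inner_sub_right, inner_smul_left, inner_smul_right,
    h4, real_inner_self_eq_norm_sq, RCLike.conj_to_real] at h2
  have h5 : 0 ≤ c * (c * inner ℝ (T x) x - ‖T x‖ ^ 2) := by linarith
  have h6 := nonneg_of_mul_nonneg_right h5 hc
  linarith

/-- `U` and `W` are symmetric, inverse to each other, and `c Id ≤ U ≤ N Id`. -/
structure IsMetricPair (U W : H →L[ℝ] H) (c N : ℝ) : Prop where
  right : ∀ x, U (W x) = x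
  left : ∀ x, W (U x) = x
  symmU : ∀ x y, inner ℝ (U x) y = inner ℝ x (U y)
  symmW : ∀ x y, inner ℝ (W x) y = inner ℝ x (W y)
  lowerU : ∀ x, c * ‖x‖ ^ 2 ≤ inner ℝ (U x) x
  upperU : ∀ x, inner ℝ (U x) x ≤ N * ‖x‖ ^ 2
  lowerW : ∀ x, ‖x‖ ^ 2 ≤ N * inner ℝ (W x) x
  upperW : ∀ x, c * inner ℝ (W x) x ≤ ‖x‖ ^ 2

theorem exists_isMetricPair [CompleteSpace H] {U : H →L[ℝ] H} {c : ℝ} (hc : 0 < c)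
    (hU : U ∈ posOps (H := H) c) (hN : 0 < ‖U‖) : ∃ W, IsMetricPair U W c ‖U‖ := by
  obtain ⟨hsa, hle⟩ := hU
  have hsymm : ∀ x y, inner ℝ (U x) y = inner ℝ x (U y) := by
    intro x y
    rw [← ContinuousLinearMap.adjoint_inner_right, hsa.adjoint_eq]
  have hlow : ∀ x, c * ‖x‖ ^ 2 ≤ inner ℝ (U x) x := by
    intro x
    have h := ((ContinuousLinearMap.le_def _ _).1 hle).inner_nonneg_left x
    simp only [sub_apply, smul_apply, inner_sub_left,
      ContinuousLinearMap.id_apply, inner_smul_left, real_inner_self_eq_norm_sq,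
      RCLike.conj_to_real] at h
    linarith
  have hup : ∀ x, inner ℝ (U x) x ≤ ‖U‖ * ‖x‖ ^ 2 := by
    intro x
    calc inner ℝ (U x) x ≤ ‖U x‖ * ‖x‖ := real_inner_le_norm _ _
      _ ≤ ‖U‖ * ‖x‖ * ‖x‖ := by gcongr; exact U.le_opNorm x
      _ = _ := by ring
  -- Coercivity gives invertibility, as in Lax-Milgram.
  have hunit : IsUnit U := by
    refine ContinuousLinearMap.isUnit_of_forall_le_norm_inner_map U (c := ⟨c, hc.le⟩) hc fun x => ?_
    have := hlow x
    have h2 := le_abs_self (inner ℝ (U x) x)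
    rw [Real.norm_eq_abs]
    change ‖x‖ ^ 2 * c ≤ _
    linarith
  obtain ⟨u, rfl⟩ := hunit
  have hright : ∀ x, (u : H →L[ℝ] H) ((↑u⁻¹ : H →L[ℝ] H) x) = x := fun x => by
    rw [← mul_apply_eq_comp, Units.mul_inv, one_apply_eq_self]
  have hleft : ∀ x, ((u⁻¹ : (H →L[ℝ] H)ˣ) : H →L[ℝ] H) ((u : H →L[ℝ] H) x) = x := fun x => by
    rw [← mul_apply_eq_comp, Units.inv_mul, one_apply_eq_self]
  refine ⟨(u⁻¹ : (H →L[ℝ] H)ˣ), hright, hleft, hsymm, ?_, hlow, hup, ?_, ?_⟩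
  · intro x y
    conv_lhs => rw [← hright y]
    rw [← hsymm, hright]
  · intro x
    have h := norm_apply_sq_le_of_nonneg_of_le hN hsymm
      (fun x => (by positivity : (0:ℝ) ≤ c * ‖x‖ ^ 2).trans (hlow x)) hup
      (((u⁻¹ : (H →L[ℝ] H)ˣ) : H →L[ℝ] H) x)
    rwa [hright, real_inner_comm] at h
  · intro x
    set w := ((u⁻¹ : (H →L[ℝ] H)ˣ) : H →L[ℝ] H) x
    have h1 := hlow w
    rw [hright] at h1
    have h2 := real_inner_le_norm x w
    have h3 : c * ‖w‖ ≤ ‖x‖ := by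
      rcases (norm_nonneg w).eq_or_lt with h | h
      · rw [← h]; simp
      · nlinarith
    calc c * inner ℝ w x = c * inner ℝ x w := by rw [real_inner_comm]
      _ ≤ c * (‖x‖ * ‖w‖) := by gcongr
      _ = ‖x‖ * (c * ‖w‖) := by ring
      _ ≤ ‖x‖ * ‖x‖ := by gcongr
      _ = _ := by ring

theorem IsMetricPair.smul {U W : H →L[ℝ] H} {c N γ : ℝ} (h : IsMetricPair U W c N) (hγ : 0 < γ) :
    IsMetricPair (γ • U) (γ⁻¹ • W) (γ * c) (γ * N) where
  right x := by simp [h.right, hγ.ne']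
  left x := by simp [h.left, hγ.ne']
  symmU x y := by simp [inner_smul_left, inner_smul_right, h.symmU]
  symmW x y := by simp [inner_smul_left, inner_smul_right, h.symmW]
  lowerU x := by
    simp only [smul_apply, inner_smul_left, RCLike.conj_to_real]
    nlinarith [h.lowerU x]
  upperU x := by
    simp only [smul_apply, inner_smul_left, RCLike.conj_to_real]
    nlinarith [h.upperU x]
  lowerW x := by
    simp only [smul_apply, inner_smul_left, RCLike.conj_to_real]
    calc _ ≤ _ := h.lowerW x
      _ = _ := by field_simp
  upperW x := by
    simp only [smul_apply, inner_smul_left, RCLike.conj_to_real]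
    calc _ = c * inner ℝ (W x) x := by field_simp
      _ ≤ _ := h.upperW x

theorem IsMetricPair.inner_inv_nonneg {U W : H →L[ℝ] H} {c N : ℝ} (h : IsMetricPair U W c N)
    (hN : 0 < N) (x : H) : 0 ≤ inner ℝ (W x) x :=
  nonneg_of_mul_nonneg_right ((sq_nonneg ‖x‖).trans (h.lowerW x)) hN

theorem IsMetricPair.norm_inv_apply_le {U W : H →L[ℝ] H} {c N : ℝ} (h : IsMetricPair U W c N)
    (x : H) : c * ‖W x‖ ≤ ‖x‖ := by
  have h1 := h.lowerU (W x)
  rw [h.right] at h1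
  have h2 := real_inner_le_norm x (W x)
  rcases (norm_nonneg (W x)).eq_or_lt with h | h
  · rw [← h]; simp
  · nlinarith

/-- The Loewner order is reversed by inversion. -/
theorem IsMetricPair.inner_inv_le {U W U' W' : H →L[ℝ] H} {c N N' t : ℝ}
    (h : IsMetricPair U W c N) (h' : IsMetricPair U' W' c N') (hN : 0 < N) (ht : 0 < t)
    (hle : ∀ x, inner ℝ (U x) x ≤ t * inner ℝ (U' x) x) (x : H) :
    inner ℝ (W' x) x ≤ t * inner ℝ (W x) x := by
  have h1 := hle (W' x)
  rw [h'.right] at h1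
  -- Completing the square in the metric of `W`: the cross term is `⟨W'x|x⟩`, and `h1` bounds the
  -- square of `U (W' x)`.
  have h2 := h.inner_inv_nonneg hN (t • x - U (W' x))
  have e1 : inner ℝ (W x) (U (W' x)) = inner ℝ (W' x) x := by
    rw [h.symmW, h.left, real_inner_comm]
  simp only [map_sub, map_smul, h.left, inner_sub_left, inner_sub_right, inner_smul_left,
    inner_smul_right, RCLike.conj_to_real, e1] at h2
  have e2 : inner ℝ (W' x) (U (W' x)) = inner ℝ (U (W' x)) (W' x) := real_inner_comm _ _
  have e3 : inner ℝ x (W' x) = inner ℝ (W' x) x := real_inner_comm _ _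
  rw [e2] at h2
  rw [e3] at h1
  have h3 : 0 ≤ t * (t * inner ℝ (W x) x - inner ℝ (W' x) x) := by linarith
  have := nonneg_of_mul_nonneg_right h3 ht
  linarith

end SymmetricOperators

/-! ### Almost decreasing real sequences -/

section Sequences

/-- A deterministic version of the Robbins-Siegmund lemma. -/
theorem exists_tendsto_and_summable_of_le {r D η δ : ℕ → ℝ} (hr : ∀ n, 0 ≤ r n)
    (hD : ∀ n, 0 ≤ D n) (hη : ∀ n, 0 ≤ η n) (hδ : ∀ n, 0 ≤ δ n) (hηs : Summable η)
    (hδs : Summable δ) (h : ∀ n, r (n + 1) ≤ (1 + η n) * r n - D n + δ n) :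
    (∃ l, Tendsto r atTop (𝓝 l)) ∧ Summable D := by
  have hbound : ∀ n, r n ≤ Real.exp (∑ k ∈ Finset.range n, η k) *
      (r 0 + ∑ k ∈ Finset.range n, δ k) := by
    intro n
    induction n with
    | zero => simp
    | succ n ih =>
      rw [Finset.sum_range_succ, Finset.sum_range_succ, Real.exp_add]
      have h1 : 1 + η n ≤ Real.exp (η n) := by linarith [Real.add_one_le_exp (η n)]
      have h2 : 1 ≤ Real.exp (∑ k ∈ Finset.range n, η k) :=
        Real.one_le_exp (Finset.sum_nonneg fun k _ => hη k)
      have h3 : 1 ≤ Real.exp (η n) := Real.one_le_exp (hη n)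
      have h4 : (1 + η n) * r n ≤ Real.exp (η n) * (Real.exp (∑ k ∈ Finset.range n, η k) *
          (r 0 + ∑ k ∈ Finset.range n, δ k)) := mul_le_mul h1 ih (hr n) (by positivity)
      have h5 : δ n ≤ Real.exp (∑ k ∈ Finset.range n, η k) * Real.exp (η n) * δ n :=
        le_mul_of_one_le_left (hδ n) (one_le_mul_of_one_le_of_one_le h2 h3)
      nlinarith [h n, hD n]
  have hK : ∀ n, r n ≤ Real.exp (∑' k, η k) * (r 0 + ∑' k, δ k) := by
    intro n
    refine (hbound n).trans ?_
    have h1 := hηs.sum_le_tsum (Finset.range n) (fun k _ => hη k)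
    have h2 := hδs.sum_le_tsum (Finset.range n) (fun k _ => hδ k)
    have h3 : 0 ≤ ∑ k ∈ Finset.range n, δ k := Finset.sum_nonneg fun k _ => hδ k
    have h4 := hr 0
    gcongr
  set K := Real.exp (∑' k, η k) * (r 0 + ∑' k, δ k)
  have hκs : Summable fun n => η n * K + δ n := (hηs.mul_right K).add hδs
  have hK0 : 0 ≤ K := (hr 0).trans (hK 0)
  have hκ : ∀ n, 0 ≤ η n * K + δ n := fun n => add_nonneg (mul_nonneg (hη n) hK0) (hδ n)
  have hstep : ∀ n, r (n + 1) ≤ r n + (η n * K + δ n) - D n := by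
    intro n
    nlinarith [h n, mul_le_mul_of_nonneg_left (hK n) (hη n)]
  constructor
  · have hanti : Antitone fun n => r n - ∑ k ∈ Finset.range n, (η k * K + δ k) := by
      refine antitone_nat_of_succ_le fun n => ?_
      rw [Finset.sum_range_succ]
      linarith [hstep n, hD n]
    have hlim := tendsto_atTop_ciInf hanti ⟨-∑' k, (η k * K + δ k), by
      rintro _ ⟨n, rfl⟩
      have := hκs.sum_le_tsum (Finset.range n) (fun k _ => hκ k)
      have := hr n
      simp only
      linarith⟩
    have := hlim.add hκs.hasSum.tendsto_sum_nat
    simp only [sub_add_cancel] at this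
    exact ⟨_, this⟩
  · refine summable_of_sum_range_le (c := r 0 + ∑' k, (η k * K + δ k)) hD fun n => ?_
    have h1 : ∑ k ∈ Finset.range n, D k ≤ r 0 - r n + ∑ k ∈ Finset.range n, (η k * K + δ k) := by
      induction n with
      | zero => simp
      | succ n ih =>
        rw [Finset.sum_range_succ, Finset.sum_range_succ]
        linarith [hstep n]
    have := hκs.sum_le_tsum (Finset.range n) (fun k _ => hκ k)
    linarith [hr n]

/-- If a real sequence is eventually almost decreasing up to summable errors, its limit lies below
each term up to the tail of the errors. -/
theorem le_add_tail_of_tendsto {r κ : ℕ → ℝ} {l : ℝ} (hκs : Summable κ)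
    (h : ∀ n, r (n + 1) ≤ r n + κ n) (hl : Tendsto r atTop (𝓝 l)) (n : ℕ) :
    l ≤ r n + (∑' k, κ k - ∑ k ∈ Finset.range n, κ k) := by
  have hanti : Antitone fun n => r n - ∑ k ∈ Finset.range n, κ k := by
    refine antitone_nat_of_succ_le fun n => ?_
    rw [Finset.sum_range_succ]
    linarith [h n]
  have := hanti.le_of_tendsto (hl.sub hκs.hasSum.tendsto_sum_nat) n
  linarith

/-- Dividing by `t` leaves `2 s n ≤ δ n / t + C t`: fix `t` small, then take `n` large. -/
theorem tendsto_zero_of_two_mul_le {s δ : ℕ → ℝ} {C ρ : ℝ} (hρ : 0 < ρ) (hC : 0 < C)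
    (hs : ∀ n, 0 ≤ s n) (hδ : Tendsto δ atTop (𝓝 0))
    (h : ∀ n, ∀ t, 0 < t → t ≤ ρ → 2 * t * s n ≤ δ n + C * t ^ 2) :
    Tendsto s atTop (𝓝 0) := by
  rw [Metric.tendsto_atTop]
  intro e he
  set t := min ρ (e / C)
  have ht : 0 < t := lt_min hρ (div_pos he hC)
  have hte : C * t ≤ e := by
    have : t ≤ e / C := min_le_right _ _
    rw [le_div_iff₀ hC] at this
    linarith
  obtain ⟨N, hN⟩ := (Metric.tendsto_atTop.1 hδ) (t * e) (mul_pos ht he)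
  refine ⟨N, fun n hn => ?_⟩
  have h1 := hN n hn
  rw [Real.dist_eq, sub_zero] at h1 ⊢
  rw [abs_of_nonneg (hs n)]
  have h2 := h n t ht (min_le_left _ _)
  have h3 := (le_abs_self _).trans_lt h1
  have h4 : t * (C * t) ≤ t * e := by gcongr
  by_contra! hcon
  have : t * e ≤ t * s n := by gcongr
  nlinarith

end Sequences

/-! ### Pointwise limits of the metrics -/

section StrongLimit

variable {H : Type*} [NormedAddCommGroup H] [InnerProductSpace ℝ H] [CompleteSpace H]

/-- An almost decreasing sequence of uniformly bounded positive operators converges strongly. -/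
theorem exists_tendsto_apply_of_almost_antitone {W : ℕ → H →L[ℝ] H} {η : ℕ → ℝ} {C : ℝ}
    (hC : 0 < C) (hη : ∀ n, 0 ≤ η n) (hηs : Summable η)
    (hsymm : ∀ n x y, inner ℝ (W n x) y = inner ℝ x (W n y))
    (h0 : ∀ n x, 0 ≤ inner ℝ (W n x) x) (hle : ∀ n x, inner ℝ (W n x) x ≤ C * ‖x‖ ^ 2)
    (hmono : ∀ n x, inner ℝ (W (n + 1) x) x ≤ (1 + η n) * inner ℝ (W n x) x) (x : H) :
    ∃ w, Tendsto (fun n => W n x) atTop (𝓝 w) := by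
  -- Dividing by the convergent products `τ n` turns almost monotonicity into genuine monotonicity
  -- of `V n`.
  set τ : ℕ → ℝ := fun n => ∏ k ∈ Finset.range n, (1 + η k)
  have hτs : ∀ n, τ (n + 1) = (1 + η n) * τ n := fun n => by
    simp only [τ]; rw [Finset.prod_range_succ, mul_comm]
  have hτ1 : ∀ n, 1 ≤ τ n := by
    intro n
    induction n with
    | zero => simp [τ]
    | succ n ih => rw [hτs]; nlinarith [hη n]
  have hτ0 : ∀ n, 0 < τ n := fun n => one_pos.trans_le (hτ1 n)
  obtain ⟨T, hT⟩ := (exists_tendsto_and_summable_of_le (r := τ) (D := fun _ => 0)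
    (δ := fun _ => 0) (fun n => (hτ0 n).le) (fun _ => le_rfl) hη (fun _ => le_rfl) hηs
    summable_zero (fun n => by simp [hτs])).1
  set V : ℕ → H →L[ℝ] H := fun n => (τ n)⁻¹ • W n
  have hVin : ∀ n y z, inner ℝ (V n y) z = (τ n)⁻¹ * inner ℝ (W n y) z := fun n y z => by
    simp [V, inner_smul_left]
  have hVanti : ∀ y, Antitone fun n => inner ℝ (V n y) y := by
    intro y
    refine antitone_nat_of_succ_le fun n => ?_
    have h1 : 0 < 1 + η n := by linarith [hη n]
    have h2 := hτ0 n
    rw [hVin, hVin, hτs]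
    calc ((1 + η n) * τ n)⁻¹ * inner ℝ (W (n + 1) y) y
        ≤ ((1 + η n) * τ n)⁻¹ * ((1 + η n) * inner ℝ (W n y) y) := by gcongr; exact hmono n y
      _ = _ := by field_simp
  have hV0 : ∀ n y, 0 ≤ inner ℝ (V n y) y := fun n y => by
    rw [hVin]; exact mul_nonneg (inv_nonneg.2 (hτ0 n).le) (h0 n y)
  have hVC : ∀ n y, inner ℝ (V n y) y ≤ C * ‖y‖ ^ 2 := fun n y => by
    rw [hVin]
    exact (mul_le_of_le_one_left (h0 n y) (inv_le_one_of_one_le₀ (hτ1 n))).trans (hle n y)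
  have hlim := tendsto_atTop_ciInf (hVanti x) ⟨0, by rintro _ ⟨n, rfl⟩; exact hV0 n x⟩
  set l := ⨅ n, inner ℝ (V n x) x
  have hcauchy : CauchySeq fun n => V n x := by
    refine cauchySeq_of_le_tendsto_0' (fun n => √(C * (inner ℝ (V n x) x - l))) ?_ ?_
    · intro n m hnm
      rw [dist_eq_norm]
      refine Real.le_sqrt_of_sq_le ?_
      -- Since `0 ≤ V n - V m ≤ C Id`, Cauchy-Schwarz bounds the norm of the difference by the gap
      -- of the convergent quadratic forms.
      have h1 := norm_apply_sq_le_of_nonneg_of_le (T := V n - V m) hC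
        (fun y z => by
          simp only [sub_apply, inner_sub_left, inner_sub_right]
          simp [V, inner_smul_left, inner_smul_right, hsymm])
        (fun y => by
          simp only [sub_apply, inner_sub_left]
          exact sub_nonneg.2 (hVanti y hnm))
        (fun y => by
          simp only [sub_apply, inner_sub_left]
          linarith [hV0 m y, hVC n y]) x
      simp only [sub_apply, inner_sub_left] at h1
      refine h1.trans ?_
      have := (hVanti x).le_of_tendsto hlim m
      gcongr
    · have : Tendsto (fun n => √(C * (inner ℝ (V n x) x - l))) atTop (𝓝 √(C * (l - l))) :=
        ((hlim.sub_const l).const_mul C).sqrt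
      simpa using this
  obtain ⟨v, hv⟩ := cauchySeq_tendsto_of_complete hcauchy
  refine ⟨T • v, (hT.smul hv).congr fun n => ?_⟩
  simp [V, (hτ0 n).ne']

end StrongLimit

/-! ### Weak convergence and ultrafilters -/

section Weak

variable {H : Type*} [NormedAddCommGroup H] [InnerProductSpace ℝ H]

theorem tendsto_inner_of_weak_of_strong {ι : Type*} {f : Filter ι} {x y : ι → H} {q w : H} {R : ℝ}
    (hR : ∀ n, ‖x n‖ ≤ R) (hx : ∀ v, Tendsto (fun n => inner ℝ (x n) v) f (𝓝 (inner ℝ q v)))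
    (hy : Tendsto y f (𝓝 w)) : Tendsto (fun n => inner ℝ (x n) (y n)) f (𝓝 (inner ℝ q w)) := by
  have h1 : Tendsto (fun n => inner ℝ (x n) (y n - w)) f (𝓝 0) := by
    refine squeeze_zero_norm (a := fun n => R * ‖y n - w‖) (fun n => ?_) ?_
    · exact (norm_inner_le_norm _ _).trans (by gcongr; exact hR n)
    · simpa using (((hy.sub_const w).norm).const_mul R)
  have := h1.add (hx w)
  simpa [← inner_add_right] using this

variable [CompleteSpace H]

theorem weaklyTendsto_iff {x : ℕ → H} {a : H} :
    WeaklyTendsto x a ↔ ∀ v, Tendsto (fun n => inner ℝ (x n) v) atTop (𝓝 (inner ℝ a v)) := by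
  have key : WeaklyTendsto x a ↔
      ∀ f : StrongDual ℝ H, Tendsto (fun n => f (x n)) atTop (𝓝 (f a)) :=
    WeakBilin.tendsto_iff_forall_eval_tendsto _ (fun p q hpq => by
      by_contra hne
      obtain ⟨f, hf⟩ := SeparatingDual.exists_separating_of_ne (R := ℝ) hne
      exact hf (LinearMap.congr_fun hpq f))
  rw [key]
  constructor
  · intro h v
    have := h (InnerProductSpace.toDual ℝ H v)
    simpa [real_inner_comm] using this
  · intro h f
    obtain ⟨v, rfl⟩ := (InnerProductSpace.toDual ℝ H).surjective f
    simpa [real_inner_comm] using h v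

/-- Bounded sequences converge weakly along every ultrafilter. -/
theorem exists_weak_ultrafilter_limit {x : ℕ → H} {R : ℝ} (hR : ∀ n, ‖x n‖ ≤ R)
    (f : Ultrafilter ℕ) :
    ∃ q, ∀ v, Tendsto (fun n => inner ℝ (x n) v) f (𝓝 (inner ℝ q v)) := by
  have hc := WeakDual.isCompact_closedBall (𝕜 := ℝ) (E := H) 0 R
  let g : ℕ → WeakDual ℝ H := fun n => StrongDual.toWeakDual (InnerProductSpace.toDual ℝ H (x n))
  have hg : ∀ n, g n ∈ WeakDual.toStrongDual ⁻¹' Metric.closedBall (0 : StrongDual ℝ H) R := by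
    intro n
    simp only [Set.mem_preimage, mem_closedBall_zero_iff]
    change ‖InnerProductSpace.toDual ℝ H (x n)‖ ≤ R
    rw [LinearIsometryEquiv.norm_map]
    exact hR n
  obtain ⟨φ, -, hφ⟩ := hc.ultrafilter_le_nhds (f.map g) (by
    rw [le_principal_iff]
    exact Filter.mem_map.2 (Filter.univ_mem' hg))
  refine ⟨(InnerProductSpace.toDual ℝ H).symm (WeakDual.toStrongDual φ), fun v => ?_⟩
  have h1 : Tendsto (fun n => g n v) f (𝓝 (φ v)) :=
    ((WeakDual.eval_continuous v).tendsto φ).comp (show Tendsto g f (𝓝 φ) from hφ)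
  rw [InnerProductSpace.toDual_symm_apply]
  exact h1

end Weak

/-! ### Minimization of strongly convex functions -/

section Minimization

theorem nonneg_of_forall_add_mul_nonneg {a b : ℝ} (h : ∀ s, 0 < s → s ≤ 1 → 0 ≤ a + s * b) :
    0 ≤ a := by
  have ht : Tendsto (fun s : ℝ => a + s * b) (𝓝[>] 0) (𝓝 (a + 0 * b)) :=
    ((continuous_const.add (continuous_id.mul continuous_const)).tendsto 0).mono_left
      nhdsWithin_le_nhds
  rw [zero_mul, add_zero] at ht
  refine ge_of_tendsto ht ?_
  filter_upwards [Ioc_mem_nhdsGT (zero_lt_one' ℝ)] with s hs using h s hs.1 hs.2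

/-- A continuous, strongly midpoint convex function plus the last coordinate attains its infimum
on a closed midpoint convex set on which it is bounded below. -/
theorem exists_forall_le_add_of_strongly_convex {E : Type*} [NormedAddCommGroup E]
    [NormedSpace ℝ E] [CompleteSpace E] {S : Set (E × ℝ)} {q : E → ℝ} {c m₀ : ℝ} (hc : 0 < c)
    (hS : IsClosed S) (hne : S.Nonempty)
    (hconv : ∀ a ∈ S, ∀ b ∈ S, (2⁻¹ : ℝ) • (a + b) ∈ S) (hq : Continuous q)
    (hmid : ∀ x y, q ((2⁻¹ : ℝ) • (x + y)) + c * ‖x - y‖ ^ 2 ≤ (q x + q y) / 2)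
    (hm : ∀ a ∈ S, m₀ ≤ a.2 + q a.1) :
    ∃ a ∈ S, ∀ b ∈ S, a.2 + q a.1 ≤ b.2 + q b.1 := by
  set J : E × ℝ → ℝ := fun a => a.2 + q a.1
  have hbdd : BddBelow (J '' S) := ⟨m₀, by rintro _ ⟨a, ha, rfl⟩; exact hm a ha⟩
  set m := sInf (J '' S)
  have hmle : ∀ a ∈ S, m ≤ J a := fun a ha => csInf_le hbdd ⟨a, ha, rfl⟩
  have hseq : ∀ n : ℕ, ∃ a ∈ S, J a < m + 1 / ((n : ℝ) + 1) := by
    intro n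
    obtain ⟨_, ⟨a, ha, rfl⟩, h⟩ := exists_lt_of_csInf_lt (hne.image J)
      (lt_add_of_pos_right m (Nat.one_div_pos_of_nat (α := ℝ) (n := n)))
    exact ⟨a, ha, h⟩
  choose a haS haJ using hseq
  -- The midpoint has value at least `m`, so strong convexity controls the distance by the average
  -- excess over `m`.
  have hdist : ∀ n k, c * ‖(a n).1 - (a k).1‖ ^ 2 ≤
      (1 / ((n : ℝ) + 1) + 1 / ((k : ℝ) + 1)) / 2 := by
    intro n k
    have h1 := hmle _ (hconv _ (haS n) _ (haS k))
    have h2 := hmid (a n).1 (a k).1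
    have h3 := haJ n
    have h4 := haJ k
    simp only [J, Prod.smul_fst, Prod.smul_snd, Prod.fst_add, Prod.snd_add, smul_eq_mul]
      at h1 h3 h4
    linarith
  have hlim0 := tendsto_one_div_add_atTop_nhds_zero_nat (𝕜 := ℝ)
  have hcauchy : CauchySeq fun n => (a n).1 := by
    refine cauchySeq_of_le_tendsto_0' (fun n => √((1 / ((n : ℝ) + 1)) / c)) ?_ ?_
    · intro n k hnk
      rw [dist_eq_norm]
      refine Real.le_sqrt_of_sq_le ?_
      rw [le_div_iff₀ hc]
      have h1 := hdist n k
      have h2 : 1 / ((k : ℝ) + 1) ≤ 1 / ((n : ℝ) + 1) := by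
        have : (n : ℝ) ≤ k := by exact_mod_cast hnk
        gcongr
      linarith
    · simpa using (hlim0.div_const c).sqrt
  obtain ⟨x, hx⟩ := cauchySeq_tendsto_of_complete hcauchy
  have hJm : Tendsto (fun n => J (a n)) atTop (𝓝 m) := by
    refine tendsto_of_tendsto_of_tendsto_of_le_of_le tendsto_const_nhds ?_
      (fun n => hmle _ (haS n)) (fun n => (haJ n).le)
    simpa using hlim0.const_add m
  have ht : Tendsto (fun n => (a n).2) atTop (𝓝 (m - q x)) := by
    refine (hJm.sub ((hq.tendsto x).comp hx)).congr fun n => ?_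
    simp [J]
  have hmem : (x, m - q x) ∈ S := hS.mem_of_tendsto (hx.prodMk_nhds ht)
    (Eventually.of_forall haS)
  exact ⟨_, hmem, fun b hb => by simpa using hmle b hb⟩

end Minimization

/-! ### Maximal monotonicity and Minty's theorem -/

section Minty

variable {H : Type*} [NormedAddCommGroup H] [InnerProductSpace ℝ H]

/-- Adjoining `(p, q)` keeps the graph monotone, so by maximality it was already there. -/
theorem IsMaximallyMonotone.mem_of_forall {A : H → Set H} (hA : IsMaximallyMonotone A) {p q : H}
    (h : ∀ y, ∀ v ∈ A y, 0 ≤ inner ℝ (p - y) (q - v)) : q ∈ A p := by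
  have hsub : ∀ x, A x ⊆ {u | u ∈ A x ∨ (x = p ∧ u = q)} := fun x u hu => Or.inl hu
  have hmono : IsMonotone fun x => {u | u ∈ A x ∨ (x = p ∧ u = q)} := by
    rintro x u (hu | ⟨rfl, rfl⟩) y v (hv | ⟨rfl, rfl⟩)
    · exact hA.1 x u hu y v hv
    · have := h x u hu
      rwa [← neg_sub x, ← neg_sub u, inner_neg_neg] at this
    · exact h y v hv
    · simp
  have := congrFun (hA.2 _ hmono hsub) p
  rw [← this]
  exact Or.inr ⟨rfl, rfl⟩

theorem IsMaximallyMonotone.exists_mem {A : H → Set H} (hA : IsMaximallyMonotone A) :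
    ∃ x u, u ∈ A x := by
  by_contra! h
  exact h 0 0 (hA.mem_of_forall fun y v hv => absurd hv (h y v))

theorem IsMaximallyMonotone.translate {A : H → Set H} (hA : IsMaximallyMonotone A) (z : H) :
    IsMaximallyMonotone fun x => A (x + z) := by
  refine ⟨fun x u hu y v hv => by simpa using hA.1 _ u hu _ v hv, fun A' hA' hsub => ?_⟩
  funext x
  refine Set.Subset.antisymm (fun u hu => hA.mem_of_forall fun y v hv => ?_) (hsub x)
  have := hA' x u hu (y - z) v (hsub _ (by simpa using hv))
  convert this using 2
  abel

variable [CompleteSpace H]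

/-- Fitzpatrick-function proof of surjectivity. A minimizer `(x₀, u₀)` of the Fitzpatrick function
plus `(⟨Wx|x⟩ + ⟨Uu|u⟩)/2` satisfies `x₀ = -U u₀`, and its optimality condition puts `-W x₀` in `A
x₀`. -/
theorem IsMetricPair.exists_neg_apply_mem {U W : H →L[ℝ] H} {c N : ℝ}
    (hUW : IsMetricPair U W c N) (hc : 0 < c) (hN : 0 < N) {A : H → Set H}
    (hA : IsMaximallyMonotone A) : ∃ x, -W x ∈ A x := by
  -- Epigraph of the Fitzpatrick function; working with it avoids infinite values.
  set S : Set ((H × H) × ℝ) :=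
    {a | ∀ y, ∀ v ∈ A y, inner ℝ y a.1.2 + inner ℝ a.1.1 v - inner ℝ y v ≤ a.2}
  set q : H × H → ℝ := fun a => (inner ℝ (W a.1) a.1 + inner ℝ (U a.2) a.2) / 2
  -- The Fitzpatrick function dominates the pairing: if it did not at `(x, u)`, then `(x, u)` would
  -- be in the graph, and testing with it gives the bound anyway.
  have hSge : ∀ a ∈ S, inner ℝ a.1.1 a.1.2 ≤ a.2 := by
    rintro ⟨⟨x, u⟩, t⟩ ha
    by_contra! hcon
    simp only at hcon
    have hmem : u ∈ A x := hA.mem_of_forall fun y v hv => by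
      have := ha y v hv
      simp only [inner_sub_left, inner_sub_right] at this ⊢
      linarith
    have := ha x u hmem
    simp only at this
    linarith
  have hsq : ∀ x u, 0 ≤ inner ℝ (W x) x + inner ℝ (U u) u + 2 * inner ℝ x u := by
    intro x u
    have h1 := hUW.inner_inv_nonneg hN (x + U u)
    have h2 : inner ℝ (W x) (U u) = inner ℝ x u := by rw [hUW.symmW, hUW.left]
    simp only [map_add, hUW.left, inner_add_left, inner_add_right, h2] at h1
    rw [real_inner_comm x u, real_inner_comm (U u) u] at h1
    linarith
  obtain ⟨⟨⟨x₀, u₀⟩, t₀⟩, ha, hmin⟩ : ∃ a ∈ S, ∀ b ∈ S, a.2 + q a.1 ≤ b.2 + q b.1 := by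
    have hc' : 0 < min N⁻¹ c / 8 := by positivity
    refine exists_forall_le_add_of_strongly_convex (m₀ := 0) hc' ?_ ?_ ?_ ?_ ?_ ?_
    · have : S = ⋂ y, ⋂ v ∈ A y,
          {a : (H × H) × ℝ | inner ℝ y a.1.2 + inner ℝ a.1.1 v - inner ℝ y v ≤ a.2} := by
        ext a; simp [S]
      rw [this]
      refine isClosed_iInter fun y => isClosed_iInter fun v => isClosed_iInter fun _ => ?_
      exact isClosed_le (by fun_prop) (by fun_prop)
    · obtain ⟨x, u, hu⟩ := hA.exists_mem
      refine ⟨((x, u), inner ℝ x u), fun y v hv => ?_⟩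
      have := hA.1 x u hu y v hv
      simp only [inner_sub_left, inner_sub_right] at this ⊢
      linarith
    · intro a ha b hb y v hv
      have h1 := ha y v hv
      have h2 := hb y v hv
      simp only [Prod.smul_fst, Prod.smul_snd, Prod.fst_add, Prod.snd_add, smul_eq_mul,
        inner_add_left, inner_add_right, inner_smul_left, inner_smul_right, RCLike.conj_to_real]
      linarith
    · fun_prop
    · rintro ⟨x, u⟩ ⟨y, v⟩
      have h1 : ‖((x, u) : H × H) - (y, v)‖ ^ 2 ≤ ‖x - y‖ ^ 2 + ‖u - v‖ ^ 2 := by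
        rw [Prod.mk_sub_mk, Prod.norm_mk]
        rcases max_choice ‖x - y‖ ‖u - v‖ with h | h <;> rw [h] <;> nlinarith [sq_nonneg ‖x - y‖,
          sq_nonneg ‖u - v‖]
      have h2 : min N⁻¹ c * ‖x - y‖ ^ 2 ≤ inner ℝ (W (x - y)) (x - y) := by
        have := hUW.lowerW (x - y)
        calc _ ≤ N⁻¹ * ‖x - y‖ ^ 2 := by gcongr; exact min_le_left _ _
          _ ≤ N⁻¹ * (N * inner ℝ (W (x - y)) (x - y)) := by gcongr
          _ = _ := by field_simp
      have h3 : min N⁻¹ c * ‖u - v‖ ^ 2 ≤ inner ℝ (U (u - v)) (u - v) := by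
        refine le_trans ?_ (hUW.lowerU (u - v))
        gcongr
        exact min_le_right _ _
      have h4 : min N⁻¹ c / 8 * ‖((x, u) : H × H) - (y, v)‖ ^ 2 ≤
          min N⁻¹ c / 8 * (‖x - y‖ ^ 2 + ‖u - v‖ ^ 2) := by gcongr
      simp only [q, map_add, map_smul,
        map_sub, inner_sub_left, inner_sub_right, Prod.mk_add_mk, Prod.smul_mk,
        inner_add_left, inner_add_right, inner_smul_left, inner_smul_right, RCLike.conj_to_real]
        at h2 h3 ⊢
      linarith
    · rintro ⟨⟨x, u⟩, t⟩ ha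
      have := hSge _ ha
      have := hsq x u
      simp only [q] at *
      linarith
  have hge := hSge _ ha
  simp only at hge
  have key : ∀ x, ∀ u ∈ A x, inner ℝ (W x₀) x₀ + inner ℝ (U u₀) u₀ + 2 * inner ℝ x₀ u₀ ≤
      inner ℝ (x + U u₀) (u + W x₀) := by
    intro x u hu
    -- First-order optimality along the segment towards `((x, u), ⟨x|u⟩)`, which stays in `S`
    -- because graph points lie in the epigraph.
    have hfirst : 0 ≤ (inner ℝ x u - t₀) + (inner ℝ (W x₀) (x - x₀) + inner ℝ (U u₀) (u - u₀)) := by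
      refine nonneg_of_forall_add_mul_nonneg
        (b := (inner ℝ (W (x - x₀)) (x - x₀) + inner ℝ (U (u - u₀)) (u - u₀)) / 2)
        fun s hs0 hs1 => ?_
      have hmem : ((x₀ + s • (x - x₀), u₀ + s • (u - u₀)), t₀ + s * (inner ℝ x u - t₀)) ∈ S := by
        intro y v hv
        have h1 := ha y v hv
        have h2 := hA.1 x u hu y v hv
        simp only [inner_sub_left, inner_sub_right, inner_add_left, inner_add_right,
          inner_smul_left, inner_smul_right, RCLike.conj_to_real] at h1 h2 ⊢
        nlinarith [mul_nonneg (sub_nonneg.2 hs1) (sub_nonneg.2 h1), mul_nonneg hs0.le h2]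
      have h1 := hmin _ hmem
      have e1 : inner ℝ (W (x - x₀)) x₀ = inner ℝ (W x₀) (x - x₀) := by
        rw [hUW.symmW, real_inner_comm]
      have e2 : inner ℝ (U (u - u₀)) u₀ = inner ℝ (U u₀) (u - u₀) := by
        rw [hUW.symmU, real_inner_comm]
      simp only [q, map_add, map_smul, inner_add_left, inner_add_right, e1, e2,
          inner_smul_left, inner_smul_right, RCLike.conj_to_real] at h1
      refine nonneg_of_mul_nonneg_right (a := s) ?_ hs0
      linarith
    have e3 : inner ℝ (U u₀) (W x₀) = inner ℝ x₀ u₀ := by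
      rw [hUW.symmU, hUW.right, real_inner_comm]
    have e4 : inner ℝ x (W x₀) = inner ℝ (W x₀) x := real_inner_comm _ _
    simp only [inner_sub_right, inner_add_left, inner_add_right, e3, e4] at hfirst ⊢
    linarith
  have hmem : -W x₀ ∈ A (-U u₀) := hA.mem_of_forall fun y v hv => by
    have h1 := (hsq x₀ u₀).trans (key y v hv)
    have e1 : -U u₀ - y = -(y + U u₀) := by abel
    have e2 : -W x₀ - v = -(v + W x₀) := by abel
    rwa [e1, e2, inner_neg_neg]
  -- Testing `key` with the graph point `(-U u₀, -W x₀)` itself gives `⟨W(x₀ + U u₀)|x₀ + U u₀⟩ ≤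
  -- 0`.
  have hzero := key _ _ hmem
  simp only [neg_add_cancel, inner_zero_left] at hzero
  have h1 := hUW.lowerW (x₀ + U u₀)
  have h2 : inner ℝ (W x₀) (U u₀) = inner ℝ x₀ u₀ := by rw [hUW.symmW, hUW.left]
  simp only [map_add, hUW.left, inner_add_left, inner_add_right, h2] at h1
  rw [real_inner_comm x₀ u₀, real_inner_comm (U u₀) u₀] at h1
  have h3 : ‖x₀ + U u₀‖ ^ 2 ≤ 0 := h1.trans
    (mul_nonpos_of_nonneg_of_nonpos hN.le (by linarith))
  have h4 : x₀ + U u₀ = 0 := by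
    rw [← norm_eq_zero]
    exact pow_eq_zero_iff two_ne_zero |>.1 (le_antisymm h3 (sq_nonneg _))
  rw [← eq_neg_of_add_eq_zero_left h4] at hmem
  exact ⟨x₀, hmem⟩

/-- Minty's theorem in the metric of `U⁻¹`: the resolvent of `U A` is single-valued with full
domain. -/
theorem IsMetricPair.resolvent_linComp_eq {U W : H →L[ℝ] H} {c N : ℝ}
    (hUW : IsMetricPair U W c N) (hc : 0 < c) (hN : 0 < N) {A : H → Set H}
    (hA : IsMaximallyMonotone A) (z : H) :
    resolvent (linComp U A) z = {resolventMap (linComp U A) z} ∧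
      ∃ w ∈ A (resolventMap (linComp U A) z),
        z - resolventMap (linComp U A) z = U w := by
  have hiff : ∀ p, p ∈ resolvent (linComp U A) z ↔ ∃ w ∈ A p, z - p = U w := by
    intro p
    simp only [resolvent, inv, Set.mem_ofPred_eq, Pi.add_apply, ofFun, id, linComp,
      Set.singleton_add, Set.mem_image, exists_exists_and_eq_and]
    refine exists_congr fun w => and_congr_right fun _ => ?_
    rw [sub_eq_iff_eq_add', eq_comm]
  have hne : (resolvent (linComp U A) z).Nonempty := by
    obtain ⟨x, hx⟩ := hUW.exists_neg_apply_mem hc hN (hA.translate z)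
    refine ⟨x + z, (hiff _).2 ⟨_, hx, ?_⟩⟩
    rw [map_neg, hUW.right]
    abel
  have hmem : resolventMap (linComp U A) z ∈ resolvent (linComp U A) z := by
    rw [resolventMap, dif_pos hne]
    exact hne.choose_spec
  refine ⟨Set.eq_singleton_iff_unique_mem.2 ⟨hmem, fun p hp => ?_⟩, (hiff _).1 hmem⟩
  obtain ⟨w, hw, hpw⟩ := (hiff _).1 hp
  obtain ⟨w', hw', hpw'⟩ := (hiff _).1 hmem
  set p' := resolventMap (linComp U A) z
  -- Uniqueness: `p - p' = -U(w - w')`, so monotonicity contradicts coercivity of `U` unless `w =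
  -- w'`.
  have h1 := hA.1 p w hw p' w' hw'
  have h2 : p - p' = - U (w - w') := by
    rw [map_sub, ← hpw, ← hpw']; abel
  have h3 := hUW.lowerU (w - w')
  rw [h2, inner_neg_left] at h1
  have h4 : ‖w - w'‖ ^ 2 = 0 := le_antisymm (by nlinarith [sq_nonneg ‖w - w'‖]) (sq_nonneg _)
  have h5 : w - w' = 0 := norm_eq_zero.1 (pow_eq_zero_iff two_ne_zero |>.1 h4)
  rw [h5, map_zero, neg_zero] at h2
  exact sub_eq_zero.1 h2

end Minty

/-! ### Estimates for one forward-backward step -/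

section ForwardBackwardStep

variable {H : Type*} [NormedAddCommGroup H] [InnerProductSpace ℝ H]

/-- The basic descent estimate of a relaxed forward-backward step in the metric of `W`. -/
theorem IsMetricPair.relaxed_step_le {U W : H →L[ℝ] H} {c N : ℝ} (hUW : IsMetricPair U W c N)
    (hN : 0 < N) {a v d : H} {β γ lam θ : ℝ} (hγ : 0 < γ) (hlam : 0 ≤ lam) (hθ : 0 < θ)
    (h1 : 0 ≤ inner ℝ (a + v) (-W v - γ • d)) (h2 : β * ‖d‖ ^ 2 ≤ inner ℝ a d) :
    inner ℝ (W (a + lam • v)) (a + lam • v) ≤ inner ℝ (W a) a -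
      (lam * (2 - lam - θ) * inner ℝ (W v) v + lam * (2 * γ * β - γ ^ 2 * N / θ) * ‖d‖ ^ 2) := by
  -- Young's inequality with weight `θ` for the cross term `2γ⟨v|d⟩`. In the application `a = x -
  -- z`, `v = p - x`, `d = Bx - Bz`.
  have h3 := hUW.inner_inv_nonneg hN (θ • v + γ • U d)
  have h4 := hUW.upperU d
  have e1 : inner ℝ (W v) (U d) = inner ℝ v d := by rw [hUW.symmW, hUW.left]
  have e2 : inner ℝ (W v) a = inner ℝ a (W v) := real_inner_comm _ _
  have e3 : inner ℝ (W a) v = inner ℝ a (W v) := hUW.symmW _ _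
  have e4 : inner ℝ v (W v) = inner ℝ (W v) v := real_inner_comm _ _
  have e5 : inner ℝ d (U d) = inner ℝ (U d) d := real_inner_comm _ _
  have e6 : inner ℝ d v = inner ℝ v d := real_inner_comm _ _
  simp only [map_add, map_smul, hUW.left, inner_add_left, inner_add_right, inner_sub_right,
    inner_neg_right, inner_smul_left, inner_smul_right, RCLike.conj_to_real, e1, e2, e3, e4, e5,
    e6] at h1 h3 ⊢
  have h5 : 0 ≤ θ * inner ℝ (W v) v + 2 * γ * inner ℝ v d + γ ^ 2 * N / θ * ‖d‖ ^ 2 := by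
    have h6 : 0 ≤ θ * (θ * inner ℝ (W v) v + 2 * γ * inner ℝ v d + γ ^ 2 * N / θ * ‖d‖ ^ 2) := by
      have : θ * (γ ^ 2 * N / θ * ‖d‖ ^ 2) = γ ^ 2 * (N * ‖d‖ ^ 2) := by field_simp
      rw [mul_add, this]
      have := mul_le_mul_of_nonneg_left h4 (sq_nonneg γ)
      linarith
    exact nonneg_of_mul_nonneg_right h6 hθ
  have h7 := mul_le_mul_of_nonneg_left h2 hγ.le
  have h8 : 2 * inner ℝ a (W v) + 2 * inner ℝ (W v) v + 2 * γ * β * ‖d‖ ^ 2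
      - θ * inner ℝ (W v) v - γ ^ 2 * N / θ * ‖d‖ ^ 2 ≤ 0 := by linarith
  have h9 := mul_le_mul_of_nonneg_left h8 hlam
  linarith

/-- With `k = γN/(2β) ≤ 1/(1+ε)`, the bound on `lam` reads `2 - lam - k ≥ ε(1 - k) ≥ ε²/(1+ε) = δ`.
Taking `θ = k + δ/2` splits this margin: half remains in `2 - lam - θ`, half makes `1 - k/θ`
positive, uniformly in the parameters. -/
theorem exists_descent_constants {β ε : ℝ} (hβ : 0 < β) (hε : 0 < ε) :
    ∃ c, 0 < c ∧ ∀ γ N lam : ℝ, 0 < N → ε ≤ γ → γ ≤ 2 * β / ((1 + ε) * N) → ε ≤ lam →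
      lam ≤ 1 + (1 - ε) * (1 - γ * N / (2 * β)) →
      ∃ θ, 0 < θ ∧ c ≤ lam * (2 - lam - θ) ∧ c ≤ lam * (2 * γ * β - γ ^ 2 * N / θ) := by
  set δ := ε ^ 2 / (1 + ε)
  have hδ : 0 < δ := by positivity
  refine ⟨min (ε * (δ / 2)) (ε * (2 * ε * β * (δ / 2) / (1 + δ / 2))), by positivity, ?_⟩
  intro γ N lam hN hγ1 hγ2 hl1 hl2
  have hγ : 0 < γ := hε.trans_le hγ1
  have hlam : 0 ≤ lam := hε.le.trans hl1
  set k := γ * N / (2 * β)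
  have hk : 0 < k := by positivity
  have hk1 : k * (1 + ε) ≤ 1 := by
    rw [le_div_iff₀ (by positivity)] at hγ2
    simp only [k]
    rw [div_mul_eq_mul_div, div_le_one (by positivity)]
    linarith
  have hδk : δ ≤ ε * (1 - k) := by
    rw [div_le_iff₀ (by positivity)]
    nlinarith
  refine ⟨k + δ / 2, by positivity, ?_, ?_⟩
  · refine (min_le_left _ _).trans ?_
    have : δ / 2 ≤ 2 - lam - (k + δ / 2) := by linarith
    gcongr
  · refine (min_le_right _ _).trans ?_
    have hkγ : γ ^ 2 * N = 2 * γ * β * k := by simp only [k]; field_simp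
    have h1 : 2 * γ * β - γ ^ 2 * N / (k + δ / 2) = 2 * γ * β * (δ / 2) / (k + δ / 2) := by
      rw [hkγ]; field_simp; ring
    rw [h1]
    have hk2 : k ≤ 1 := by nlinarith
    gcongr

/-- Effect of a perturbation on the squared norm in the metric of `W`. -/
theorem IsMetricPair.inner_inv_add_le {U W : H →L[ℝ] H} {c N : ℝ} (hUW : IsMetricPair U W c N)
    (hc : 0 < c) (hN : 0 < N) (y e : H) :
    inner ℝ (W (y + e)) (y + e) ≤
      (1 + ‖e‖) * inner ℝ (W y) y + c⁻¹ * (‖e‖ ^ 2 + ‖e‖) := by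
  rcases eq_or_ne e 0 with rfl | he
  · simp
  have he' : 0 < ‖e‖ := norm_pos_iff.2 he
  -- The weight `‖e‖` in Young's inequality makes both resulting coefficients summable along
  -- summable errors.
  have h1 := hUW.inner_inv_nonneg hN (‖e‖ • y - e)
  have h2 : inner ℝ (W e) e ≤ c⁻¹ * ‖e‖ ^ 2 := by
    rw [inv_mul_eq_div, le_div_iff₀ hc, mul_comm]; exact hUW.upperW e
  have e1 : inner ℝ (W e) y = inner ℝ (W y) e := by rw [hUW.symmW, real_inner_comm]
  simp only [map_add, map_sub, map_smul, inner_add_left, inner_add_right, inner_sub_left,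
    inner_sub_right, inner_smul_left, inner_smul_right, RCLike.conj_to_real, e1] at h1 ⊢
  have h3 : ‖e‖ * (2 * inner ℝ (W y) e) ≤ ‖e‖ * (‖e‖ * inner ℝ (W y) y + c⁻¹ * ‖e‖) := by
    linarith
  have h4 := le_of_mul_le_mul_left h3 he'
  linarith

/-- Lipschitz estimate for the resolvent in the metric of `U⁻¹`, for perturbations `U b`. -/
theorem IsMetricPair.norm_sub_le_of_resolvent {U W : H →L[ℝ] H} {c N : ℝ}
    (hUW : IsMetricPair U W c N) (hN : 0 < N) {A : H → Set H} (hA : IsMonotone A)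
    {z b p p' w w' : H} (hw : w ∈ A p) (hw' : w' ∈ A p') (hp : z - p = U w)
    (hp' : z - U b - p' = U w') : ‖p' - p‖ ≤ N * ‖b‖ := by
  have h1 := hA p' w' hw' p w hw
  have h2 : W (p' - p) = -b - (w' - w) := by
    have : p' - p = -U b - (U w' - U w) := by rw [← hp, ← hp']; abel
    rw [this]
    simp [hUW.left]
  have h3 := hUW.lowerW (p' - p)
  rw [h2, inner_sub_left, inner_neg_left, real_inner_comm (p' - p) (w' - w)] at h3
  have h4 := neg_le_of_abs_le (abs_real_inner_le_norm b (p' - p))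
  have h5 : ‖p' - p‖ ^ 2 ≤ N * (‖b‖ * ‖p' - p‖) := h3.trans (by gcongr; linarith)
  rcases (norm_nonneg (p' - p)).eq_or_lt with h | h
  · rw [← h]; positivity
  · nlinarith

end ForwardBackwardStep

/-! ### Variable metric quasi-Fejér sequences -/

section Fejer

variable {H : Type*} [NormedAddCommGroup H] [InnerProductSpace ℝ H]

/-- Opial's argument for variable metric quasi-Fejér sequences. -/
theorem exists_weaklyTendsto_of_fejer [CompleteSpace H] {W : ℕ → H →L[ℝ] H} {M R : ℝ} {Z : Set H}
    {x : ℕ → H} (hsymm : ∀ n u v, inner ℝ (W n u) v = inner ℝ u (W n v))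
    (hlow : ∀ n v, ‖v‖ ^ 2 ≤ M * inner ℝ (W n v) v)
    (hlim : ∀ v, ∃ w, Tendsto (fun n => W n v) atTop (𝓝 w)) (hR : ∀ n, ‖x n‖ ≤ R)
    (hfejer : ∀ z ∈ Z, ∃ l, Tendsto (fun n => inner ℝ (W n (x n - z)) (x n - z)) atTop (𝓝 l))
    (hcluster : ∀ (f : Ultrafilter ℕ) (q : H), (f : Filter ℕ) ≤ atTop →
      (∀ v, Tendsto (fun n => inner ℝ (x n) v) f (𝓝 (inner ℝ q v))) → q ∈ Z) :
    ∃ z ∈ Z, WeaklyTendsto x z := by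
  have hunique : ∀ (f f' : Ultrafilter ℕ) (q q' : H), (f : Filter ℕ) ≤ atTop →
      (f' : Filter ℕ) ≤ atTop →
      (∀ v, Tendsto (fun n => inner ℝ (x n) v) f (𝓝 (inner ℝ q v))) →
      (∀ v, Tendsto (fun n => inner ℝ (x n) v) f' (𝓝 (inner ℝ q' v))) → q = q' := by
    intro f f' q q' hf hf' hq hq'
    obtain ⟨l, hl⟩ := hfejer q (hcluster f q hf hq)
    obtain ⟨l', hl'⟩ := hfejer q' (hcluster f' q' hf' hq')
    obtain ⟨w, hw⟩ := hlim q
    obtain ⟨w', hw'⟩ := hlim q'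
    -- The terms quadratic in `x n` cancel between the two squared distances, so this pairing
    -- converges along the whole sequence.
    have h1 : Tendsto (fun n => inner ℝ (x n) (W n (q - q'))) atTop
        (𝓝 ((l' - l + inner ℝ w q - inner ℝ w' q') / 2)) := by
      refine ((((hl'.sub hl).add (hw.inner tendsto_const_nhds)).sub
        (hw'.inner tendsto_const_nhds)).div_const 2).congr fun n => ?_
      have e1 : ∀ y, inner ℝ (W n (x n)) y = inner ℝ (x n) (W n y) := hsymm n (x n)
      have e2 : ∀ y, inner ℝ (W n y) (x n) = inner ℝ (x n) (W n y) := fun y =>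
        real_inner_comm _ _
      simp only [map_sub, inner_sub_left, inner_sub_right, e1, e2]
      ring
    have hW : Tendsto (fun n => W n (q - q')) atTop (𝓝 (w - w')) := by
      simpa using hw.sub hw'
    have h2 := tendsto_nhds_unique (h1.mono_left hf)
      (tendsto_inner_of_weak_of_strong hR hq (hW.mono_left hf))
    have h3 := tendsto_nhds_unique (h1.mono_left hf')
      (tendsto_inner_of_weak_of_strong hR hq' (hW.mono_left hf'))
    have h4 : inner ℝ (w - w') (q - q') = 0 := by
      rw [real_inner_comm, inner_sub_left, ← h2, ← h3, sub_self]
    have h5 : ‖q - q'‖ ^ 2 ≤ M * inner ℝ (w - w') (q - q') :=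
      ge_of_tendsto ((hW.inner tendsto_const_nhds).const_mul M)
        (Eventually.of_forall fun n => hlow n (q - q'))
    rw [h4, mul_zero] at h5
    exact sub_eq_zero.1 (norm_eq_zero.1 (pow_eq_zero_iff two_ne_zero |>.1
      (le_antisymm h5 (sq_nonneg _))))
  obtain ⟨f₀, hf₀⟩ := Ultrafilter.exists_le (atTop : Filter ℕ)
  obtain ⟨q₀, hq₀⟩ := exists_weak_ultrafilter_limit hR f₀
  refine ⟨q₀, hcluster f₀ q₀ hf₀ hq₀, weaklyTendsto_iff.2 fun v => ?_⟩
  rw [tendsto_iff_ultrafilter]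
  intro f hf
  obtain ⟨q, hq⟩ := exists_weak_ultrafilter_limit hR f
  rw [hunique f₀ f q₀ q hf₀ hf hq₀ hq]
  exact hq v

/-- The distances to all points `z₀ + h` of a ball in `Z` almost decrease with common errors.
Comparing each with its limit bounds `⟨W n (x n - z₀) - w | h⟩` uniformly in `h`, so `W n (x n -
z₀)` converges in norm; pairing it with the weakly convergent `x n - q` finishes. -/
theorem tendsto_of_fejer_of_interior_nonempty [CompleteSpace H] {W : ℕ → H →L[ℝ] H}
    {M C R : ℝ} {Z : Set H} {x : ℕ → H} {q : H} {η κ : ℕ → ℝ} (hM : 0 < M)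
    (hC : 0 < C)
    (hsymm : ∀ n u v, inner ℝ (W n u) v = inner ℝ u (W n v))
    (hlow : ∀ n v, ‖v‖ ^ 2 ≤ M * inner ℝ (W n v) v)
    (hup : ∀ n v, inner ℝ (W n v) v ≤ C * ‖v‖ ^ 2)
    (hlim : ∀ v, ∃ w, Tendsto (fun n => W n v) atTop (𝓝 w)) (hR : ∀ n, ‖x n‖ ≤ R)
    (hη : ∀ n, 0 ≤ η n) (hηs : Summable η) (hκs : Summable κ)
    (hfejer : ∀ z ∈ Z, ∀ n, inner ℝ (W (n + 1) (x (n + 1) - z)) (x (n + 1) - z) ≤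
      (1 + η n) * inner ℝ (W n (x n - z)) (x n - z) + κ n)
    (hconv : ∀ z ∈ Z, ∃ l, Tendsto (fun n => inner ℝ (W n (x n - z)) (x n - z)) atTop (𝓝 l))
    (hweak : WeaklyTendsto x q) (hint : (interior Z).Nonempty) :
    Tendsto x atTop (𝓝 q) := by
  rw [weaklyTendsto_iff] at hweak
  obtain ⟨z₀, hz₀⟩ := hint
  obtain ⟨ρ, hρ, hball⟩ := Metric.nhds_basis_closedBall.mem_iff.1 (mem_interior_iff_mem_nhds.1 hz₀)
  have hmem : ∀ h : H, ‖h‖ ≤ ρ → z₀ + h ∈ Z := fun h hh => hball (by simpa using hh)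
  have hz₀Z : z₀ ∈ Z := by simpa using hmem 0 (by simpa using hρ.le)
  obtain ⟨l, hl⟩ := hconv z₀ hz₀Z
  obtain ⟨w, hw⟩ := hlim (q - z₀)
  -- Bound on all squared distances to the ball: it turns the factor `1 + η n` into an additive
  -- error independent of `h`.
  set K := C * (R + (‖z₀‖ + ρ)) ^ 2
  have hσs : Summable fun n => η n * K + κ n := (hηs.mul_right K).add hκs
  set σ : ℕ → ℝ := fun n => ∑' k, (η k * K + κ k) - ∑ k ∈ Finset.range n, (η k * K + κ k)
  have hσ : Tendsto σ atTop (𝓝 0) := by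
    simpa using hσs.hasSum.tendsto_sum_nat.const_sub (∑' k, (η k * K + κ k))
  have hxz : ∀ v, Tendsto (fun n => inner ℝ (x n - z₀) v) atTop (𝓝 (inner ℝ (q - z₀) v)) :=
    fun v => by simpa [inner_sub_left] using (hweak v).sub_const (inner ℝ z₀ v)
  have hRz : ∀ n, ‖x n - z₀‖ ≤ R + ‖z₀‖ := fun n => (norm_sub_le _ _).trans (by gcongr; exact hR n)
  have hmain : ∀ n (h : H), ‖h‖ ≤ ρ → 2 * inner ℝ (W n (x n - z₀) - w) h ≤
      inner ℝ (W n (x n - z₀)) (x n - z₀) - l + σ n + C * ‖h‖ ^ 2 := by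
    intro n h hh
    obtain ⟨w', hw'⟩ := hlim h
    have hexp : ∀ m, inner ℝ (W m (x m - (z₀ + h))) (x m - (z₀ + h)) =
        inner ℝ (W m (x m - z₀)) (x m - z₀) - 2 * inner ℝ (W m (x m - z₀)) h +
          inner ℝ (W m h) h := by
      intro m
      have e1 : inner ℝ (W m h) (x m - z₀) = inner ℝ (W m (x m - z₀)) h := by
        rw [hsymm, real_inner_comm]
      rw [← sub_sub]
      simp only [map_sub _ (x m - z₀) h, inner_sub_left _ _ (x m - z₀ - h),
        inner_sub_right _ (x m - z₀) h, e1]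
      ring
    have hlimh : Tendsto (fun m => inner ℝ (W m (x m - z₀)) h) atTop (𝓝 (inner ℝ w h)) := by
      have h1 : Tendsto (fun m => inner ℝ (x m - z₀) (W m h)) atTop (𝓝 (inner ℝ (q - z₀) w')) :=
        tendsto_inner_of_weak_of_strong hRz hxz hw'
      have h2 : inner ℝ (q - z₀) w' = inner ℝ w h :=
        tendsto_nhds_unique (tendsto_const_nhds.inner hw')
          ((hw.inner tendsto_const_nhds).congr fun m => hsymm m _ _)
      rw [← h2]
      exact h1.congr fun m => (hsymm m _ _).symm
    have hlim2 : Tendsto (fun m => inner ℝ (W m (x m - (z₀ + h))) (x m - (z₀ + h))) atTop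
        (𝓝 (l - 2 * inner ℝ w h + inner ℝ w' h)) :=
      ((hl.sub (hlimh.const_mul 2)).add (hw'.inner tendsto_const_nhds)).congr
        fun m => (hexp m).symm
    have hstep : ∀ m, inner ℝ (W (m + 1) (x (m + 1) - (z₀ + h))) (x (m + 1) - (z₀ + h)) ≤
        inner ℝ (W m (x m - (z₀ + h))) (x m - (z₀ + h)) + (η m * K + κ m) := by
      intro m
      have h1 := hfejer _ (hmem h hh) m
      have h2 : inner ℝ (W m (x m - (z₀ + h))) (x m - (z₀ + h)) ≤ K := by
        refine (hup m _).trans ?_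
        have h3 : ‖x m - (z₀ + h)‖ ≤ R + (‖z₀‖ + ρ) :=
          (norm_sub_le _ _).trans (add_le_add (hR m) ((norm_add_le _ _).trans (by gcongr)))
        exact mul_le_mul_of_nonneg_left (pow_le_pow_left₀ (norm_nonneg _) h3 2) hC.le
      linarith [mul_le_mul_of_nonneg_left h2 (hη m)]
    have h1 := le_add_tail_of_tendsto hσs hstep hlim2 n
    rw [hexp] at h1
    have h2 : 0 ≤ inner ℝ w' h := by
      refine ge_of_tendsto (hw'.inner (tendsto_const_nhds (x := h))) (Eventually.of_forall fun m => ?_)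
      exact nonneg_of_mul_nonneg_right ((sq_nonneg ‖h‖).trans (hlow m h)) hM
    have h3 := hup n h
    rw [inner_sub_left]
    linarith
  have hstrong : Tendsto (fun n => W n (x n - z₀)) atTop (𝓝 w) := by
    rw [tendsto_iff_norm_sub_tendsto_zero]
    refine tendsto_zero_of_two_mul_le hρ hC (fun n => norm_nonneg _)
      (δ := fun n => inner ℝ (W n (x n - z₀)) (x n - z₀) - l + σ n) ?_ ?_
    · simpa using (hl.sub_const l).add hσ
    · intro n t ht htρ
      rcases eq_or_ne (W n (x n - z₀) - w) 0 with h0 | h0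
      · have := hmain n 0 (by simpa using hρ.le)
        simp only [inner_zero_right, norm_zero] at this
        rw [h0, norm_zero]
        have : 0 ≤ C * t ^ 2 := by positivity
        linarith
      · have hne := norm_ne_zero_iff.2 h0
        have hnorm : ‖(t / ‖W n (x n - z₀) - w‖) • (W n (x n - z₀) - w)‖ = t := by
          rw [norm_smul, Real.norm_of_nonneg (by positivity)]; field_simp
        -- The vector of norm `t` along `W n (x n - z₀) - w` turns the pairing into a norm.
        have := hmain n ((t / ‖W n (x n - z₀) - w‖) • (W n (x n - z₀) - w)) (hnorm.trans_le htρ)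
        rw [hnorm, inner_smul_right, real_inner_self_eq_norm_sq] at this
        calc _ = 2 * (t / ‖W n (x n - z₀) - w‖ * ‖W n (x n - z₀) - w‖ ^ 2) := by field_simp
          _ ≤ _ := this
  have hzero : Tendsto (fun n => inner ℝ (x n - q) (W n (x n - q))) atTop
      (𝓝 (inner ℝ (q - q) (w - w))) := by
    refine tendsto_inner_of_weak_of_strong (R := R + ‖q‖)
      (fun n => (norm_sub_le _ _).trans (by gcongr; exact hR n))
      (fun v => by simpa [inner_sub_left] using (hweak v).sub_const (inner ℝ q v)) ?_
    refine (hstrong.sub hw).congr fun n => ?_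
    rw [← map_sub]; congr 1; abel
  rw [sub_self, inner_zero_left] at hzero
  rw [tendsto_iff_norm_sub_tendsto_zero]
  have hsq : Tendsto (fun n => ‖x n - q‖ ^ 2) atTop (𝓝 0) := by
    have hbd := hzero.const_mul M
    rw [mul_zero] at hbd
    refine squeeze_zero (fun n => sq_nonneg _) (fun n => ?_) hbd
    rw [real_inner_comm]
    exact hlow n _
  simpa using hsq.sqrt

end Fejer

/-! ### Zeros of the sum as weak cluster points -/

section Zeros

theorem mem_zer_add_ofFun {H : Type*} [NormedAddCommGroup H] {A : H → Set H} {B : H → H} {q : H} :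
    q ∈ zer (A + ofFun B) ↔ -B q ∈ A q := by
  simp only [zer, ofFun, Set.mem_ofPred_eq, Pi.add_apply, Set.add_singleton, Set.mem_image]
  constructor
  · rintro ⟨u, hu, h⟩
    rwa [← eq_neg_of_add_eq_zero_left h]
  · exact fun h => ⟨_, h, neg_add_cancel _⟩

variable {H : Type*} [NormedAddCommGroup H] [InnerProductSpace ℝ H]

/-- The graph of a sum of a maximally monotone and a cocoercive operator is closed under weak
convergence of the points when the values of the two operators converge strongly. -/
theorem mem_zer_of_weak_of_strong {ι : Type*} {f : Filter ι} [f.NeBot] {A : H → Set H}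
    (hA : IsMaximallyMonotone A) {B : H → H} {β : ℝ} (hβ : 0 < β) (hB : IsCocoercive β B)
    {x p w : ι → H} {q u : H} {R : ℝ} (hR : ∀ n, ‖x n‖ ≤ R)
    (hx : ∀ v, Tendsto (fun n => inner ℝ (x n) v) f (𝓝 (inner ℝ q v)))
    (hpx : Tendsto (fun n => p n - x n) f (𝓝 0)) (hw : ∀ n, w n ∈ A (p n))
    (hBx : Tendsto (fun n => B (x n)) f (𝓝 u)) (hwu : Tendsto w f (𝓝 (-u))) :
    B q = u ∧ q ∈ zer (A + ofFun B) := by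
  have hsub : ∀ y s t, Tendsto s f (𝓝 t) →
      Tendsto (fun n => inner ℝ (x n - y) (s n)) f (𝓝 (inner ℝ (q - y) t)) := by
    intro y s t hs
    simp only [inner_sub_left]
    exact (tendsto_inner_of_weak_of_strong hR hx hs).sub (tendsto_const_nhds.inner hs)
  have hBq : B q = u := by
    -- Cocoercivity between `x n` and `q`: the pairing tends to `⟨q - q | u - B q⟩ = 0`.
    have h1 := hsub q _ _ (hBx.sub_const (B q))
    have h2 := le_of_tendsto_of_tendsto (((hBx.sub_const (B q)).norm.pow 2).const_mul β) h1
      (Eventually.of_forall fun n => hB (x n) q)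
    rw [sub_self, inner_zero_left] at h2
    have h3 : ‖u - B q‖ ^ 2 ≤ 0 := by
      by_contra! h
      have := mul_pos hβ h
      linarith
    exact (sub_eq_zero.1 (norm_eq_zero.1 (pow_eq_zero_iff two_ne_zero |>.1
      (le_antisymm h3 (sq_nonneg _))))).symm
  refine ⟨hBq, mem_zer_add_ofFun.2 (hA.mem_of_forall fun y v hv => ?_)⟩
  rw [hBq]
  have h1 : Tendsto (fun n => inner ℝ (x n - y) (w n - v) + inner ℝ (p n - x n) (w n - v)) f
      (𝓝 (inner ℝ (q - y) (-u - v) + inner ℝ 0 (-u - v))) :=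
    (hsub y _ _ (hwu.sub_const v)).add (hpx.inner (hwu.sub_const v))
  rw [inner_zero_left, add_zero] at h1
  refine ge_of_tendsto h1 (Eventually.of_forall fun n => ?_)
  have := hA.1 _ _ (hw n) y v hv
  rwa [← inner_add_left, sub_add_sub_comm, add_comm (x n), add_sub_add_right_eq_sub]

theorem summable_mul_of_nonneg {f g : ℕ → ℝ} (hf : ∀ n, 0 ≤ f n) (hg : ∀ n, 0 ≤ g n)
    (hfs : Summable f) (hgs : Summable g) : Summable fun n => f n * g n :=
  Summable.of_nonneg_of_le (fun n => mul_nonneg (hf n) (hg n))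
    (fun n => mul_le_mul_of_nonneg_left (hgs.le_tsum n fun k _ => hg k) (hf n))
    (hfs.mul_right (∑' k, g k))

end Zeros

end MonotoneOp

/-! ### Convergence of the algorithm -/

open MonotoneOp in
theorem proposition4p4 {H : Type*} [NormedAddCommGroup H] [InnerProductSpace ℝ H]
    [CompleteSpace H]
    (β : ℝ) (hβ : 0 < β) (ε : ℝ) (hε : ε ∈ Set.Ioo 0 (min (1 / 2) β))
    (α : ℝ) (hα : 0 < α)
    (η : ℕ → ℝ) (hη_nonneg : ∀ n, 0 ≤ η n) (hη_sum : Summable η)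
    (U : ℕ → H →L[ℝ] H) (hU : ∀ n, U n ∈ MonotoneOp.posOps (H := H) α)
    (hU_bdd : BddAbove (Set.range fun n => ‖U n‖))
    (hU_mono : ∀ n, U n ≤ (1 + η n) • U (n + 1))
    (A : H → Set H) (hA : MonotoneOp.IsMaximallyMonotone A)
    (B : H → H) (hB : MonotoneOp.IsCocoercive β B)
    (a b : ℕ → H) (ha : Summable fun n => ‖a n‖) (hb : Summable fun n => ‖b n‖)
    (hzer : (MonotoneOp.zer (A + MonotoneOp.ofFun B)).Nonempty)
    (γ : ℕ → ℝ) (hγ : ∀ n, γ n ∈ Set.Icc ε (2 * β / ((1 + ε) * ‖U n‖)))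
    (lam : ℕ → ℝ)
    (hlam : ∀ n, lam n ∈ Set.Icc ε (1 + (1 - ε) * (1 - γ n * ‖U n‖ / (2 * β))))
    (x : ℕ → H)
    (hx : ∀ n, x (n + 1) = x n + lam n •
      (MonotoneOp.resolventMap (MonotoneOp.linComp (γ n • U n) A)
        (x n - γ n • U n (B (x n) + b n)) + a n - x n)) :
    -- the resolvents in the iteration are single-valued and defined on all of `H`
    (∀ n z, MonotoneOp.resolvent (MonotoneOp.linComp (γ n • U n) A) z =
      {MonotoneOp.resolventMap (MonotoneOp.linComp (γ n • U n) A) z}) ∧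
    -- (i)
    (Summable fun n => ‖MonotoneOp.resolventMap (MonotoneOp.linComp (γ n • U n) A)
      (x n - γ n • U n (B (x n))) - x n‖ ^ 2) ∧
    -- (ii)
    (∀ z ∈ MonotoneOp.zer (A + MonotoneOp.ofFun B),
      Summable fun n => ‖B (x n) - B z‖ ^ 2) ∧
    -- (iii)
    (∃ z ∈ MonotoneOp.zer (A + MonotoneOp.ofFun B), MonotoneOp.WeaklyTendsto x z) ∧
    -- (iv)
    (((∀ z ∈ MonotoneOp.zer (A + MonotoneOp.ofFun B), MonotoneOp.IsDemiregularAt A z) ∨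
      (∀ z ∈ MonotoneOp.zer (A + MonotoneOp.ofFun B),
        MonotoneOp.IsDemiregularAt (MonotoneOp.ofFun B) z) ∨
      (interior (MonotoneOp.zer (A + MonotoneOp.ofFun B))).Nonempty) →
      ∃ z ∈ MonotoneOp.zer (A + MonotoneOp.ofFun B), Tendsto x atTop (𝓝 z)) := by
  obtain ⟨hε0, hε1⟩ := hε
  have hε2 : ε < 1 / 2 := hε1.trans_le (min_le_left _ _)
  have hγ0 : ∀ n, 0 < γ n := fun n => hε0.trans_le (hγ n).1
  have hlam0 : ∀ n, 0 < lam n := fun n => hε0.trans_le (hlam n).1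
  -- If `‖U n‖ = 0`, the upper bound for `γ n` is a division by zero, hence `0`, contradicting `γ n
  -- ≥ ε`.
  have hN : ∀ n, 0 < ‖U n‖ := by
    intro n
    refine (norm_nonneg _).lt_of_ne' fun h => ?_
    have := (hγ0 n).trans_le (hγ n).2
    rw [h] at this
    simp at this
  have hγN : ∀ n, γ n * ‖U n‖ ≤ 2 * β := by
    intro n
    have h1 := (hγ n).2
    rw [le_div_iff₀ (mul_pos (by linarith) (hN n))] at h1
    nlinarith [mul_pos (hγ0 n) (hN n)]
  have hlam2 : ∀ n, lam n ≤ 2 := by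
    intro n
    have h1 : 0 ≤ γ n * ‖U n‖ / (2 * β) := by have := hγ0 n; positivity
    nlinarith [(hlam n).2]
  obtain ⟨M, hM⟩ := hU_bdd
  replace hM : ∀ n, ‖U n‖ ≤ M := fun n => hM ⟨n, rfl⟩
  have hM0 : 0 < M := (hN 0).trans_le (hM 0)
  choose W hW using fun n => exists_isMetricPair hα (hU n) (hN n)
  have hW0 : ∀ n v, 0 ≤ inner ℝ (W n v) v := fun n => (hW n).inner_inv_nonneg (hN n)
  have hWlow : ∀ n v, ‖v‖ ^ 2 ≤ M * inner ℝ (W n v) v := fun n v =>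
    ((hW n).lowerW v).trans (mul_le_mul_of_nonneg_right (hM n) (hW0 n v))
  have hWup : ∀ n v, inner ℝ (W n v) v ≤ α⁻¹ * ‖v‖ ^ 2 := fun n v => by
    rw [inv_mul_eq_div, le_div_iff₀ hα, mul_comm]; exact (hW n).upperW v
  have hWmono : ∀ n v, inner ℝ (W (n + 1) v) v ≤ (1 + η n) * inner ℝ (W n v) v := by
    intro n
    refine (hW n).inner_inv_le (hW (n + 1)) (hN n) (by linarith [hη_nonneg n]) fun v => ?_
    have h := ((ContinuousLinearMap.le_def _ _).1 (hU_mono n)).inner_nonneg_left v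
    simp only [sub_apply, smul_apply, inner_sub_left, inner_smul_left, RCLike.conj_to_real] at h
    linarith
  have hWlim : ∀ v, ∃ w, Tendsto (fun n => W n v) atTop (𝓝 w) :=
    exists_tendsto_apply_of_almost_antitone (inv_pos.2 hα) hη_nonneg hη_sum
      (fun n => (hW n).symmW) hW0 hWup hWmono
  have hres : ∀ n z, _ := fun n z => ((hW n).smul (hγ0 n)).resolvent_linComp_eq
    (mul_pos (hγ0 n) hα) (mul_pos (hγ0 n) (hN n)) hA z
  refine ⟨fun n z => (hres n z).1, ?_⟩
  set p : ℕ → H := fun n => resolventMap (linComp (γ n • U n) A) (x n - γ n • U n (B (x n)))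
  set p' : ℕ → H := fun n =>
    resolventMap (linComp (γ n • U n) A) (x n - γ n • U n (B (x n) + b n))
  choose w hwA hw using fun n => (hres n (x n - γ n • U n (B (x n)))).2
  choose w' hwA' hw' using fun n => (hres n (x n - γ n • U n (B (x n) + b n))).2
  have hpp' : ∀ n, ‖p' n - p n‖ ≤ 2 * β * ‖b n‖ := by
    intro n
    have h1 := ((hW n).smul (hγ0 n)).norm_sub_le_of_resolvent (b := b n)
      (mul_pos (hγ0 n) (hN n)) hA.1 (hwA n) (hwA' n) (hw n) (by
        rw [← hw' n]; simp only [smul_apply, map_add, smul_add]; abel)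
    exact h1.trans (mul_le_mul_of_nonneg_right (hγN n) (norm_nonneg _))
  -- Both perturbations become one additive error; the resolvent is `2β`-Lipschitz in `b n`,
  -- uniformly in `n`.
  set e : ℕ → H := fun n => lam n • (p' n - p n + a n)
  have hxe : ∀ n, x (n + 1) = x n + lam n • (p n - x n) + e n := by
    intro n
    rw [hx n]
    change x n + lam n • (p' n + a n - x n) = _
    simp only [e]
    module
  have hes : Summable fun n => ‖e n‖ := by
    refine Summable.of_nonneg_of_le (fun n => norm_nonneg _) (fun n => ?_)
      (((hb.mul_left (2 * β)).add ha).mul_left 2)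
    rw [norm_smul, Real.norm_of_nonneg (hlam0 n).le]
    gcongr
    · exact hlam2 n
    · exact (norm_add_le _ _).trans (by gcongr; exact hpp' n)
  have hes2 : Summable fun n => ‖e n‖ ^ 2 := by
    simpa only [sq] using
      summable_mul_of_nonneg (fun n => norm_nonneg (e n)) (fun n => norm_nonneg (e n)) hes hes
  have hηe : Summable fun n => η n * ‖e n‖ :=
    summable_mul_of_nonneg hη_nonneg (fun n => norm_nonneg (e n)) hη_sum hes
  obtain ⟨c, hc, hconst⟩ := exists_descent_constants hβ hε0
  set Z := zer (A + ofFun B)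
  set δ : ℕ → ℝ := fun n => α⁻¹ * (‖e n‖ ^ 2 + ‖e n‖)
  have hδ : ∀ n, 0 ≤ δ n := fun n => by positivity
  have hδs : Summable δ := (hes2.add hes).mul_left _
  set κ : ℕ → ℝ := fun n => (1 + η n) * δ n
  have hκ : ∀ n, 0 ≤ κ n := fun n => mul_nonneg (by linarith [hη_nonneg n]) (hδ n)
  have hκs : Summable κ :=
    (hδs.add (summable_mul_of_nonneg hη_nonneg hδ hη_sum hδs)).congr fun n => by
      simp only [κ]; ring
  -- `1 + η' n = (1 + η n)(1 + ‖e n‖)` combines the change of metric with the error.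
  set η' : ℕ → ℝ := fun n => η n + ‖e n‖ + η n * ‖e n‖
  have hη' : ∀ n, 0 ≤ η' n := fun n => by have := hη_nonneg n; positivity
  have hη's : Summable η' := (hη_sum.add hes).add hηe
  have hWw : ∀ n, -W n (p n - x n) = γ n • (w n + B (x n)) := by
    intro n
    have h1 : p n - x n = -(γ n • U n (w n + B (x n))) := by
      have h2 : x n - γ n • U n (B (x n)) - p n = γ n • U n (w n) := hw n
      rw [map_add, smul_add, ← h2]; abel
    rw [h1]
    simp only [map_neg, map_smul, (hW n).left, neg_neg]
  have hdescent : ∀ z ∈ Z, ∀ n, inner ℝ (W (n + 1) (x (n + 1) - z)) (x (n + 1) - z) ≤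
      (1 + η' n) * inner ℝ (W n (x n - z)) (x n - z) -
        c * (inner ℝ (W n (p n - x n)) (p n - x n) + ‖B (x n) - B z‖ ^ 2) + κ n := by
    intro z hz n
    obtain ⟨θ, hθ, hc1, hc2⟩ := hconst (γ n) ‖U n‖ (lam n) (hN n) (hγ n).1 (hγ n).2 (hlam n).1
      (hlam n).2
    have hmon := hA.1 (p n) (w n) (hwA n) z (-B z) (mem_zer_add_ofFun.1 hz)
    have h1 : 0 ≤ inner ℝ (x n - z + (p n - x n))
        (-W n (p n - x n) - γ n • (B (x n) - B z)) := by
      rw [hWw, ← smul_sub, inner_smul_right]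
      refine mul_nonneg (hγ0 n).le ?_
      have e1 : x n - z + (p n - x n) = p n - z := by abel
      have e2 : w n + B (x n) - (B (x n) - B z) = w n - -B z := by abel
      rw [e1, e2]
      exact hmon
    have h2 := (hW n).relaxed_step_le (hN n) (hγ0 n) (hlam0 n).le hθ h1 (hB (x n) z)
    have h3 := (hW n).inner_inv_add_le hα (hN n) (x n - z + lam n • (p n - x n)) (e n)
    have h4 : x (n + 1) - z = x n - z + lam n • (p n - x n) + e n := by rw [hxe]; abel
    have h5 := hWmono n (x (n + 1) - z)
    rw [← h4] at h3
    set Y := inner ℝ (W n (x n - z + lam n • (p n - x n))) (x n - z + lam n • (p n - x n))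
    set X := inner ℝ (W n (x n - z)) (x n - z)
    set V := inner ℝ (W n (p n - x n)) (p n - x n)
    have hV : 0 ≤ V := hW0 n _
    set D := c * (V + ‖B (x n) - B z‖ ^ 2)
    have hD : 0 ≤ D := by positivity
    have h6 : Y ≤ X - D := by
      have g1 := mul_le_mul_of_nonneg_right hc1 hV
      have g2 := mul_le_mul_of_nonneg_right hc2 (sq_nonneg ‖B (x n) - B z‖)
      simp only [D]
      linarith
    have hη1 : 0 ≤ 1 + η n := by linarith [hη_nonneg n]
    have h7 := mul_le_mul_of_nonneg_left h3 hη1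
    have h8 : (1 + η n) * ((1 + ‖e n‖) * Y) ≤ (1 + η n) * ((1 + ‖e n‖) * (X - D)) := by gcongr
    have h9 : (1 + η n) * ((1 + ‖e n‖) * (X - D)) = (1 + η' n) * X - D - η' n * D := by
      simp only [η']; ring
    have h10 := mul_nonneg (hη' n) hD
    have h11 : κ n = (1 + η n) * (α⁻¹ * (‖e n‖ ^ 2 + ‖e n‖)) := rfl
    linarith
  have hRS : ∀ z ∈ Z, (∃ l, Tendsto (fun n => inner ℝ (W n (x n - z)) (x n - z)) atTop (𝓝 l)) ∧
      Summable fun n => c * (inner ℝ (W n (p n - x n)) (p n - x n) + ‖B (x n) - B z‖ ^ 2) :=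
    fun z hz => exists_tendsto_and_summable_of_le (fun n => hW0 n _)
      (fun n => mul_nonneg hc.le (add_nonneg (hW0 n _) (sq_nonneg _))) hη' hκ hη's hκs
      (hdescent z hz)
  have hsum : ∀ z ∈ Z, Summable fun n =>
      inner ℝ (W n (p n - x n)) (p n - x n) + ‖B (x n) - B z‖ ^ 2 :=
    fun z hz => (summable_mul_left_iff hc.ne').1 (hRS z hz).2
  obtain ⟨z₁, hz₁⟩ := hzer
  have hi : Summable fun n => ‖p n - x n‖ ^ 2 := by
    refine Summable.of_nonneg_of_le (fun n => sq_nonneg _) (fun n => ?_)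
      ((hsum z₁ hz₁).mul_left M)
    refine (hWlow n _).trans (mul_le_mul_of_nonneg_left ?_ hM0.le)
    exact le_add_of_nonneg_right (sq_nonneg _)
  have hii : ∀ z ∈ Z, Summable fun n => ‖B (x n) - B z‖ ^ 2 := fun z hz =>
    Summable.of_nonneg_of_le (fun n => sq_nonneg _)
      (fun n => le_add_of_nonneg_left (hW0 n _)) (hsum z hz)
  have hpx : Tendsto (fun n => p n - x n) atTop (𝓝 0) := by
    rw [tendsto_zero_iff_norm_tendsto_zero]
    simpa using hi.tendsto_atTop_zero.sqrt
  have hBx : ∀ z ∈ Z, Tendsto (fun n => B (x n)) atTop (𝓝 (B z)) := by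
    intro z hz
    rw [tendsto_iff_norm_sub_tendsto_zero]
    simpa using (hii z hz).tendsto_atTop_zero.sqrt
  have hwB : ∀ z ∈ Z, Tendsto w atTop (𝓝 (-B z)) := by
    intro z hz
    -- By `hWw` this is `-γₙ⁻¹ Wₙ(pₙ - xₙ)`, with `γₙ ≥ ε` and `‖Wₙ‖ ≤ α⁻¹`.
    have h1 : Tendsto (fun n => w n + B (x n)) atTop (𝓝 0) := by
      refine squeeze_zero_norm (a := fun n => ε⁻¹ * (α⁻¹ * ‖p n - x n‖)) (fun n => ?_) ?_
      · have h2 := (hW n).norm_inv_apply_le (p n - x n)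
        rw [← norm_neg, hWw, norm_smul, Real.norm_of_nonneg (hγ0 n).le] at h2
        have h3 : α * (ε * ‖w n + B (x n)‖) ≤ ‖p n - x n‖ := by
          refine le_trans ?_ h2
          gcongr
          exact (hγ n).1
        rw [inv_mul_eq_div, inv_mul_eq_div, le_div_iff₀ hε0, le_div_iff₀ hα]
        linarith
      · simpa using (hpx.norm.const_mul α⁻¹).const_mul ε⁻¹
    simpa using h1.sub (hBx z hz)
  obtain ⟨l₁, hl₁⟩ := (hRS z₁ hz₁).1
  obtain ⟨R, hR⟩ : ∃ R, ∀ n, ‖x n‖ ≤ R := by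
    obtain ⟨K, hK⟩ := hl₁.bddAbove_range
    refine ⟨√(M * K) + ‖z₁‖, fun n => ?_⟩
    have h1 : ‖x n - z₁‖ ≤ √(M * K) := by
      refine Real.le_sqrt_of_sq_le ((hWlow n _).trans ?_)
      gcongr
      exact hK ⟨n, rfl⟩
    have h2 := norm_sub_norm_le (x n) z₁
    linarith
  obtain ⟨q, hqZ, hq⟩ : ∃ z ∈ Z, WeaklyTendsto x z := by
    refine exists_weaklyTendsto_of_fejer (fun n => (hW n).symmW) hWlow hWlim hR
      (fun z hz => (hRS z hz).1) fun f q hf hq => ?_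
    exact (mem_zer_of_weak_of_strong hA hβ hB hR hq (hpx.mono_left hf) hwA
      ((hBx z₁ hz₁).mono_left hf) ((hwB z₁ hz₁).mono_left hf)).2
  refine ⟨hi, hii, ⟨q, hqZ, hq⟩, fun h => ⟨q, hqZ, ?_⟩⟩
  rcases h with h | h | h
  -- Demiregularity of `A` needs graph points, so it is applied to `(p n, w n)` and transferred to
  -- `x n` by `hpx`.
  · have hpq : WeaklyTendsto p q := by
      rw [weaklyTendsto_iff] at hq ⊢
      intro v
      have := (hq v).add (hpx.inner (tendsto_const_nhds (x := v)))
      simpa [← inner_add_left] using this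
    have hp := (h q hqZ).2 p w hwA (-B q) (mem_zer_add_ofFun.1 hqZ) hpq (hwB q hqZ)
    simpa using hp.sub hpx
  · exact (h q hqZ).2 x (fun n => B (x n)) (fun n => rfl) (B q) rfl hq (hBx q hqZ)
  · refine tendsto_of_fejer_of_interior_nonempty hM0 (inv_pos.2 hα) (fun n => (hW n).symmW) hWlow
      hWup hWlim hR hη' hη's hκs (fun z hz n => ?_) (fun z hz => (hRS z hz).1) hq h
    have h1 : 0 ≤ c * (inner ℝ (W n (p n - x n)) (p n - x n) + ‖B (x n) - B z‖ ^ 2) :=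
      mul_nonneg hc.le (add_nonneg (hW0 n _) (sq_nonneg _))
    linarith [hdescent z hz n]
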